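/- For integers $n,g\ge 0$ put $f_n(g)=n(g+1)-\frac{g(g+3)}{2}$. All graphs are finite and simple. An $R_g$-cutset of a graph $G$ is a set $S$ of vertices such that $G-S$ is disconnected and every connected component of $G-S$ has at least $g+1$ vertices; if $G$ has an $R_g$-cutset, the $g$-extra connectivity $\kappa_g(G)$ is the minimum cardinality of an $R_g$-cutset of $G$. The classes of $n$-dimensional hypercube-like networks (HL-networks) are defined recursively, up to isomorphism: the only $0$-dimensional HL-network is $K_1$, and for $n\ge 1$ the $n$-dimensional HL-networks are the graphs obtained from the disjoint union of two $(n-1)$-dimensional HL-networks $G_0,G_1$ by adding the edges of a perfect matching between $V(G_0)$ and $V(G_1)$. For $k\ge 0$ let $D_8^k=H_1\times\cdots\times H_k$, where $H_i=\langle a_i,b_i\mid a_i^4=b_i^2=1,\ b_i^{-1}a_ib_i=a_i^{-1}\rangle$ is the dihedral group of order $8$, and let $\Gamma_{k,0}=\mathrm{Cay}(D_8^k,\{a_i^2,b_i,a_ib_i\mid 1\le i\le k\})$ be the graph with vertex set $D_8^k$ and edges $\{x,sx\}$ for $x\in D_8^k$ and $s$ in the given set. Theorem. 1. For every $k\ge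 0$, $\Gamma_{k,0}$ is a $3k$-dimensional HL-network. 2. If $2k+1\le g\le 3k-4$, then $\Gamma_{k,0}$ has an $R_g$-cutset and $\kappa_g(\Gamma_{k,0})>f_{3k}(g)$. 3. Consequently, it is not true that $\kappa_g(G)=f_n(g)$ for all $n\ge 5$, all $0\le g\le n-3$ and all $n$-dimensional HL-networks $G$ that have an $R_g$-cutset. -/

import Mathlib

universe u

/-- The Cayley graph `Cay(G, S)`: vertex set `G`, edges `{x, s x}` with `s ∈ S`
(no loops; `S` is inverse-closed in all uses). -/
def cayleyGraph {G : Type u} [Group G] (S : Set G) : SimpleGraph G :=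
  SimpleGraph.fromRel (fun x y => ∃ s ∈ S, y = s * x)

/-- The graph `G₀ ⊕ G₁` obtained from the disjoint union of `G₀` and `G₁` by adding the edges
`{v, φ v}` of the perfect matching between the two vertex sets given by the bijection `φ`. -/
def matchingSum {V₀ V₁ : Type u} (G₀ : SimpleGraph V₀) (G₁ : SimpleGraph V₁) (φ : V₀ ≃ V₁) :
    SimpleGraph (V₀ ⊕ V₁) :=
  SimpleGraph.fromRel (fun x y =>
    match x, y with
    | Sum.inl a, Sum.inl b => G₀.Adj a b
    | Sum.inr a, Sum.inr b => G₁.Adj a b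
    | Sum.inl a, Sum.inr b => φ a = b
    | Sum.inr _, Sum.inl _ => False)

/-- `IsHLNetwork n G`: `G` is (isomorphic to) an `n`-dimensional hypercube-like network. -/
def IsHLNetwork : ℕ → ∀ {V : Type u}, SimpleGraph V → Prop
  | 0, _, G => Nonempty (G ≃g (⊥ : SimpleGraph PUnit.{u + 1}))
  | n + 1, _, G => ∃ (V₀ V₁ : Type u) (G₀ : SimpleGraph V₀) (G₁ : SimpleGraph V₁) (φ : V₀ ≃ V₁),
      IsHLNetwork n G₀ ∧ IsHLNetwork n G₁ ∧ Nonempty (G ≃g matchingSum G₀ G₁ φ)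

/-- `S` is an `R_g`-cutset of `G`: the graph `G - S` is disconnected (it has two vertices that are
not joined by a path), and every connected component of `G - S` has at least `g + 1` vertices. -/
def IsExtraCutset {V : Type u} (G : SimpleGraph V) (g : ℕ) (S : Finset V) : Prop :=
  ¬ (G.induce ((S : Set V)ᶜ)).Preconnected ∧
    ∀ C : (G.induce ((S : Set V)ᶜ)).ConnectedComponent, g + 1 ≤ C.supp.ncard

/-- The `g`-extra connectivity of a finite graph: the minimum cardinality of an `R_g`-cutset
(meaningful if there is one). -/
noncomputable def extraConnectivity {V : Type u} (G : SimpleGraph V) (g : ℕ) : ℕ :=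
  sInf {m : ℕ | ∃ S : Finset V, IsExtraCutset G g S ∧ S.card = m}

/-- `f_n(g) = n (g + 1) - g (g + 3) / 2`. -/
def extraBound (n g : ℕ) : ℚ :=
  (n : ℚ) * ((g : ℚ) + 1) - (g : ℚ) * ((g : ℚ) + 3) / 2

/-- The connection set `{a_i², b_i, a_i b_i | i}` in the `k`-th power of the dihedral group of
order `8`, where `a_i` and `b_i` are the rotation `r 1` of order `4` and the reflection `sr 0`
in the `i`-th factor. -/
def dihedralConnectionSet (k : ℕ) : Set (Fin k → DihedralGroup 4) :=
  {x | ∃ i : Fin k,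
    x = Pi.mulSingle i ((DihedralGroup.r 1) ^ 2) ∨
    x = Pi.mulSingle i (DihedralGroup.sr 0) ∨
    x = Pi.mulSingle i (DihedralGroup.r 1 * DihedralGroup.sr 0)}

/-- The graph `Γ_{k,0} = Cay(D_8^k, {a_i², b_i, a_i b_i | i})`. -/
def dihedralCayleyGraph (k : ℕ) : SimpleGraph (Fin k → DihedralGroup 4) :=
  cayleyGraph (dihedralConnectionSet k)

/-! Two inequalities hold in every `n`-dimensional HL-network, both by induction over the two halves
joined by a matching. A nonempty set of `m` vertices has vertex boundary at least `f_n(m - 1)`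
(`isoBound_le_boundaryIn`). A separator between two nonadjacent sets with at least `m` vertices each
has at least `f_n(m - 1)` vertices, if `m = 1` or `m + 2 ≤ n` (`isoBound_le_separator`).

In `Γ_{k,0}` the first inequality is strict for sets of at least `2k + 2` vertices
(`isoBound_lt_boundaryIn`). Each reflection generator `b_j` or `a_j b_j` gives a perfect matching
between two HL-halves. If equality holds for `A`, every such splitting that is nontrivial on `A`
isolates a single vertex of `A`. Since `b_j` and `a_j b_j` have a product of order 4, they cannot
both split `A` when `A` has at least 5 vertices, so at most `k` reflections split `A`, which forces
`|A| ≤ 2k + 1`. If no reflection splits `A`, its `2k` disjoint translates by reflections already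
make the boundary too large.

An `R_g`-cutset separates two sets of at least `g + 1` vertices. If one has exactly `g + 1`,
strictness applies; otherwise the separation bound with `m = g + 2` exceeds `f_{3k}(g)`. -/

/-- `isoBound n m = 2 f_n(m - 1)`, twice the lower bound for the size of the boundary of a set of
`m` vertices in an `n`-dimensional HL-network. -/
def isoBound (n m : ℤ) : ℤ := 2 * n * m - (m - 1) * (m + 2)

/-! ### HL-subsets of a fixed graph and the vertex-isoperimetric inequality. -/

/-- `IsHLSubset G n U`: the vertices in `U` induce an `n`-dimensional HL-network in `G`. -/
inductive IsHLSubset {V : Type u} [DecidableEq V] (G : SimpleGraph V) : ℕ → Finset V → Prop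
  | singleton (v : V) : IsHLSubset G 0 {v}
  | join {n : ℕ} {U₀ U₁ : Finset V} (f : V → V) (h₀ : IsHLSubset G n U₀) (h₁ : IsHLSubset G n U₁)
      (hd : Disjoint U₀ U₁) (hf : Set.BijOn f U₀ U₁)
      (hadj : ∀ x ∈ U₀, ∀ y ∈ U₁, G.Adj x y ↔ y = f x) : IsHLSubset G (n + 1) (U₀ ∪ U₁)

open Classical in
/-- The vertices of `U` outside `A` that have a neighbour in `A ∩ U`. -/
noncomputable def boundaryIn {V : Type u} (G : SimpleGraph V) (U A : Finset V) : Finset V :=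
  U.filter (fun v => v ∉ A ∧ ∃ a ∈ A, a ∈ U ∧ G.Adj a v)

theorem mem_boundaryIn {V : Type u} {G : SimpleGraph V} {U A : Finset V} {v : V} :
    v ∈ boundaryIn G U A ↔ v ∈ U ∧ v ∉ A ∧ ∃ a ∈ A, a ∈ U ∧ G.Adj a v := by
  simp [boundaryIn]

theorem boundaryIn_subset {V : Type u} (G : SimpleGraph V) (U A : Finset V) :
    boundaryIn G U A ⊆ U := fun _ hv => (mem_boundaryIn.1 hv).1

theorem boundaryIn_mono {V : Type u} (G : SimpleGraph V) {U U' : Finset V} (A : Finset V)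
    (h : U ⊆ U') : boundaryIn G U A ⊆ boundaryIn G U' A := by
  intro v hv
  obtain ⟨h1, h2, a, h3, h4, h5⟩ := mem_boundaryIn.1 hv
  exact mem_boundaryIn.2 ⟨h h1, h2, a, h3, h h4, h5⟩

theorem IsHLNetwork.of_iso {n : ℕ} {V W : Type u} {G : SimpleGraph V} {H : SimpleGraph W}
    (h : IsHLNetwork n G) (e : H ≃g G) : IsHLNetwork n H := by
  cases n with
  | zero =>
    obtain ⟨f⟩ := h
    exact ⟨e.trans f⟩
  | succ n =>
    obtain ⟨V₀, V₁, G₀, G₁, φ, h₀, h₁, ⟨f⟩⟩ := h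
    exact ⟨V₀, V₁, G₀, G₁, φ, h₀, h₁, ⟨e.trans f⟩⟩

namespace IsHLSubset

variable {V : Type u} [DecidableEq V] {G : SimpleGraph V}

theorem isHLNetwork {n : ℕ} {U : Finset V} (h : IsHLSubset G n U) :
    IsHLNetwork n (G.induce (U : Set V)) := by
  induction h with
  | singleton v =>
    refine ⟨⟨⟨fun _ => PUnit.unit, fun _ => ⟨v, by simp⟩, ?_, fun _ => rfl⟩, ?_⟩⟩
    · rintro ⟨x, hx⟩
      have : x = v := by simpa using hx
      subst this; rfl
    · rintro ⟨x, hx⟩ ⟨y, hy⟩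
      have hx' : x = v := by simpa using hx
      have hy' : y = v := by simpa using hy
      subst hx'; subst hy'
      simp
  | @join n U₀ U₁ f h₀ h₁ hd hf hadj ih₀ ih₁ =>
    have hd' : Disjoint (U₀ : Set V) (U₁ : Set V) := by exact_mod_cast hd
    let F : (U₀ : Set V) ⊕ (U₁ : Set V) ≃ ((U₀ ∪ U₁ : Finset V) : Set V) :=
      ((Equiv.setCongr (Finset.coe_union U₀ U₁)).trans (Equiv.Set.union hd')).symm
    have hl : ∀ a, (F (Sum.inl a) : V) = a := by
      intro a; rfl
    have hr : ∀ a, (F (Sum.inr a) : V) = a := by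
      intro a; rfl
    refine ⟨_, _, _, _, hf.equiv, ih₀, ih₁, ⟨SimpleGraph.Iso.symm ⟨F, ?_⟩⟩⟩
    rintro (a | a) (b | b)
    · have := a.2; have := b.2
      simp only [SimpleGraph.comap_adj, Function.Embedding.subtype_apply, hl, matchingSum,
        SimpleGraph.fromRel_adj, ne_eq, Sum.inl.injEq]
      constructor
      · intro h
        exact ⟨fun hab => h.ne (congrArg _ hab), Or.inl h⟩
      · rintro ⟨-, h | h⟩
        · exact h
        · exact h.symm
    · simp only [SimpleGraph.comap_adj, Function.Embedding.subtype_apply, hl, hr, matchingSum,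
        SimpleGraph.fromRel_adj, ne_eq, reduceCtorEq, not_false_eq_true, true_and, or_false]
      rw [hadj a a.2 b b.2, Subtype.ext_iff]
      exact eq_comm
    · simp only [SimpleGraph.comap_adj, Function.Embedding.subtype_apply, hl, hr, matchingSum,
        SimpleGraph.fromRel_adj, ne_eq, reduceCtorEq, not_false_eq_true, true_and, false_or]
      rw [G.adj_comm, hadj b b.2 a a.2, Subtype.ext_iff]
      exact eq_comm
    · simp only [SimpleGraph.comap_adj, Function.Embedding.subtype_apply, hr, matchingSum,
        SimpleGraph.fromRel_adj, ne_eq, Sum.inr.injEq]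
      constructor
      · intro h
        exact ⟨fun hab => h.ne (congrArg _ hab), Or.inl h⟩
      · rintro ⟨-, h | h⟩
        · exact h
        · exact h.symm

theorem card_eq {n : ℕ} {U : Finset V} (h : IsHLSubset G n U) : U.card = 2 ^ n := by
  induction h with
  | singleton v => simp
  | join f h₀ h₁ hd hf hadj ih₀ ih₁ =>
    rw [Finset.card_union_of_disjoint hd, ih₀, ih₁]; ring

theorem card_inter_union {U₀ U₁ : Finset V} (A : Finset V) (hd : Disjoint U₀ U₁) :
    (A ∩ (U₀ ∪ U₁)).card = (A ∩ U₀).card + (A ∩ U₁).card := by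
  rw [Finset.inter_union_distrib_left, Finset.card_union_of_disjoint]
  exact hd.mono Finset.inter_subset_right Finset.inter_subset_right

theorem card_le_boundaryIn_of_inter_eq_empty {U₀ U₁ A : Finset V} {f : V → V}
    (hf : Set.BijOn f U₀ U₁) (hadj : ∀ x ∈ U₀, G.Adj x (f x)) (h : A ∩ U₁ = ∅) :
    (A ∩ U₀).card ≤ (boundaryIn G (U₀ ∪ U₁) A ∩ U₁).card := by
  refine Finset.card_le_card_of_injOn f ?_ ?_
  · intro x hx
    obtain ⟨hxA, hxU⟩ := Finset.mem_inter.1 hx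
    have hfx : f x ∈ U₁ := hf.mapsTo hxU
    refine Finset.mem_inter.2 ⟨mem_boundaryIn.2 ⟨Finset.mem_union_right _ hfx, ?_, x, hxA,
      Finset.mem_union_left _ hxU, hadj x hxU⟩, hfx⟩
    intro hA
    have : f x ∈ A ∩ U₁ := Finset.mem_inter.2 ⟨hA, hfx⟩
    simp [h] at this
  · exact hf.injOn.mono (by intro x hx; exact (Finset.mem_inter.1 hx).2)

theorem card_le_boundaryIn_of_inter_eq_empty' {U₀ U₁ A : Finset V} {f : V → V}
    (hf : Set.BijOn f U₀ U₁) (hadj : ∀ x ∈ U₀, G.Adj x (f x)) (h : A ∩ U₀ = ∅) :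
    (A ∩ U₁).card ≤ (boundaryIn G (U₀ ∪ U₁) A ∩ U₀).card := by
  refine le_trans (Finset.card_le_card ?_) (Finset.card_image_le (f := f))
  intro y hy
  obtain ⟨hyA, hyU⟩ := Finset.mem_inter.1 hy
  obtain ⟨x, hx, rfl⟩ := hf.surjOn hyU
  refine Finset.mem_image.2 ⟨x, Finset.mem_inter.2 ⟨mem_boundaryIn.2 ⟨Finset.mem_union_left _ hx,
    ?_, f x, hyA, Finset.mem_union_right _ hyU, (hadj x hx).symm⟩, hx⟩, rfl⟩
  intro hA
  have : x ∈ A ∩ U₀ := Finset.mem_inter.2 ⟨hA, hx⟩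
  simp [h] at this

/-- Boundaries inside the halves add up, and `isoBound (n + 1) (a + b) = isoBound n a + isoBound n b
- 2 (a - 1) (b - 1)`. If `A` misses one half, the matching puts a copy of `A` into the boundary
there, and `isoBound (n + 1) a = isoBound n a + 2 a`. -/
theorem isoBound_le_boundaryIn {n : ℕ} {U : Finset V} (h : IsHLSubset G n U) (A : Finset V)
    (hA : 1 ≤ (A ∩ U).card) :
    isoBound n (A ∩ U).card ≤ 2 * (boundaryIn G U A).card := by
  induction h with
  | singleton v =>
    have : (A ∩ {v}).card ≤ 1 := (Finset.card_le_card Finset.inter_subset_right).trans (by simp)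
    have : (A ∩ {v}).card = 1 := le_antisymm this hA
    rw [this]
    simp [isoBound]
  | @join n U₀ U₁ f h₀ h₁ hd hf hadj ih₀ ih₁ =>
    have hadj' : ∀ x ∈ U₀, G.Adj x (f x) := fun x hx => (hadj x hx _ (hf.mapsTo hx)).2 rfl
    have hN : (boundaryIn G (U₀ ∪ U₁) A).card = (boundaryIn G (U₀ ∪ U₁) A ∩ U₀).card +
        (boundaryIn G (U₀ ∪ U₁) A ∩ U₁).card := by
      rw [← card_inter_union _ hd, Finset.inter_eq_left.2 (boundaryIn_subset _ _ _)]
    have hN₀ : (boundaryIn G U₀ A).card ≤ (boundaryIn G (U₀ ∪ U₁) A ∩ U₀).card :=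
      Finset.card_le_card (Finset.subset_inter (boundaryIn_mono _ _ Finset.subset_union_left)
        (boundaryIn_subset _ _ _))
    have hN₁ : (boundaryIn G U₁ A).card ≤ (boundaryIn G (U₀ ∪ U₁) A ∩ U₁).card :=
      Finset.card_le_card (Finset.subset_inter (boundaryIn_mono _ _ Finset.subset_union_right)
        (boundaryIn_subset _ _ _))
    rw [card_inter_union A hd] at hA ⊢
    have c₀ := card_le_boundaryIn_of_inter_eq_empty (A := A) hf hadj'
    have c₁ := card_le_boundaryIn_of_inter_eq_empty' (A := A) hf hadj'
    rw [← Finset.card_eq_zero] at c₀ c₁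
    rw [hN]
    generalize (A ∩ U₀).card = a₀ at *
    generalize (A ∩ U₁).card = a₁ at *
    generalize (boundaryIn G (U₀ ∪ U₁) A ∩ U₀).card = N₀ at *
    generalize (boundaryIn G (U₀ ∪ U₁) A ∩ U₁).card = N₁ at *
    unfold isoBound at *
    rcases Nat.eq_zero_or_pos a₁ with ha₁ | ha₁
    · have := c₀ ha₁
      have := ih₀ (by omega)
      subst ha₁
      push_cast
      nlinarith
    · rcases Nat.eq_zero_or_pos a₀ with ha₀ | ha₀
      · have := c₁ ha₀
        have := ih₁ (by omega)
        subst ha₀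
        push_cast
        nlinarith
      · have i₀ := ih₀ ha₀
        have i₁ := ih₁ ha₁
        have : (0 : ℤ) ≤ ((a₀ : ℤ) - 1) * (a₁ - 1) :=
          mul_nonneg (by omega) (by omega)
        push_cast
        nlinarith

end IsHLSubset

/-! ### The separation inequality in HL-networks. -/

/-- For the cases where the separator contains all but at most `m - 1` of `2 ^ n` vertices, so that
its size alone suffices. -/
theorem isoBound_add_le_two_pow {n m : ℕ} (hm : 1 ≤ m) (h : m = 1 ∨ m + 1 ≤ n) :
    isoBound (n + 1) m + 2 * (m - 1) ≤ 2 * 2 ^ n := by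
  have key : ∀ d : ℕ, ((d : ℤ) + 3) * (d + 4) + 2 * (d + 1) ≤ 2 * 2 ^ (d + 3) := by
    intro d
    induction d with
    | zero => norm_num
    | succ d ih =>
      rw [show d + 1 + 3 = (d + 3) + 1 from rfl, pow_succ]
      push_cast
      nlinarith
  have hlin : ∀ n : ℕ, (n : ℤ) + 1 ≤ 2 ^ n := by
    intro n
    exact_mod_cast Nat.lt_two_pow_self
  rcases h with rfl | h
  · have := hlin n
    simp only [isoBound, Nat.cast_one]
    linarith
  · rcases Nat.eq_or_lt_of_le hm with rfl | hm2
    · have := hlin n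
      simp only [isoBound, Nat.cast_one]
      linarith
    · obtain ⟨d, rfl⟩ : ∃ d, n = d + 3 := ⟨n - 3, by omega⟩
      have := key d
      -- The left side increases with `m` up to the extreme value `m = n - 1 = d + 2`, where the
      -- claim is `key`; `e` is the distance from it.
      obtain ⟨e, he⟩ : ∃ e, d + 2 = m + e := ⟨d + 2 - m, by omega⟩
      have he' : (m : ℤ) = d + 2 - e := by omega
      have he0 : (0 : ℤ) ≤ e := by omega
      unfold isoBound
      rw [he']
      push_cast
      nlinarith [mul_nonneg he0 he0]

theorem isoBound_add {n a b : ℤ} (ha : 1 ≤ a) (hb : 1 ≤ b) :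
    isoBound (n + 1) (a + b) ≤ isoBound n a + isoBound n b := by
  have : (0 : ℤ) ≤ (a - 1) * (b - 1) := mul_nonneg (by omega) (by omega)
  unfold isoBound
  nlinarith

/-- The case of the induction step for the separation bound in which one of the two separated sets
misses a half. -/
theorem isoBound_le_of_right_eq_zero {n m a₀ b₀ s₀ s₁ : ℕ} (hm : 1 ≤ m)
    (hmn : m = 1 ∨ m + 1 ≤ n) (c₀ : a₀ + b₀ + s₀ = 2 ^ n)
    (ha : m ≤ a₀) (has : a₀ ≤ s₁)
    (ih : ∀ p : ℕ, 1 ≤ p → (p = 1 ∨ p + 2 ≤ n) → p ≤ a₀ → p ≤ b₀ → isoBound n p ≤ 2 * s₀)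
    (q : 1 ≤ a₀ → 1 ≤ b₀ → isoBound n a₀ ≤ 2 * s₀) :
    isoBound (n + 1) m ≤ 2 * (s₀ + s₁) := by
  by_cases hb : m ≤ b₀
  · by_cases hp : m = 1 ∨ m + 2 ≤ n
    · have := ih m hm hp ha hb
      unfold isoBound at *
      nlinarith
    · rcases Nat.eq_or_lt_of_le ha with rfl | ha'
      · have := q hm (by omega)
        unfold isoBound at *
        nlinarith
      -- In this border case the induction hypothesis is available only for `m - 1`. This loses `2
      -- (n - m) = 2`, regained from `s₁ ≥ a₀ ≥ m + 1`.
      · obtain rfl : n = m + 1 := by omega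
        obtain ⟨p, rfl⟩ : ∃ p, m = p + 1 := ⟨m - 1, by omega⟩
        have := ih p (by omega) (by omega) (by omega) (by omega)
        unfold isoBound at *
        push_cast at *
        nlinarith
  -- Here `s₀ + s₁ ≥ s₀ + a₀ = 2 ^ n - b₀` with `b₀ ≤ m - 1`.
  · have := isoBound_add_le_two_pow hm hmn
    have c : ((a₀ : ℤ) + b₀ + s₀) = 2 ^ n := by exact_mod_cast c₀
    omega

/-- The induction step for the separation bound, in terms of the cardinalities of the traces of the
two separated sets and of the separator on the two halves. -/
theorem isoBound_le_of_halves {n m a₀ b₀ s₀ a₁ b₁ s₁ : ℕ} (hm : 1 ≤ m)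
    (hmn : m = 1 ∨ m + 1 ≤ n) (c₀ : a₀ + b₀ + s₀ = 2 ^ n) (c₁ : a₁ + b₁ + s₁ = 2 ^ n)
    (ha : m ≤ a₀ + a₁) (hb : m ≤ b₀ + b₁)
    (ma₀ : a₀ ≤ a₁ + s₁) (ma₁ : a₁ ≤ a₀ + s₀) (mb₀ : b₀ ≤ b₁ + s₁) (mb₁ : b₁ ≤ b₀ + s₀)
    (ih₀ : ∀ p : ℕ, 1 ≤ p → (p = 1 ∨ p + 2 ≤ n) → p ≤ a₀ → p ≤ b₀ → isoBound n p ≤ 2 * s₀)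
    (ih₁ : ∀ p : ℕ, 1 ≤ p → (p = 1 ∨ p + 2 ≤ n) → p ≤ a₁ → p ≤ b₁ → isoBound n p ≤ 2 * s₁)
    (qa₀ : 1 ≤ a₀ → isoBound n a₀ ≤ 2 * s₀) (qb₀ : 1 ≤ b₀ → isoBound n b₀ ≤ 2 * s₀)
    (qa₁ : 1 ≤ a₁ → isoBound n a₁ ≤ 2 * s₁) (qb₁ : 1 ≤ b₁ → isoBound n b₁ ≤ 2 * s₁) :
    isoBound (n + 1) m ≤ 2 * (s₀ + s₁) := by
  have ih₀' : ∀ p : ℕ, 1 ≤ p → (p = 1 ∨ p + 2 ≤ n) → p ≤ b₀ → p ≤ a₀ → isoBound n p ≤ 2 * s₀ :=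
    fun p h1 h2 h3 h4 => ih₀ p h1 h2 h4 h3
  have ih₁' : ∀ p : ℕ, 1 ≤ p → (p = 1 ∨ p + 2 ≤ n) → p ≤ b₁ → p ≤ a₁ → isoBound n p ≤ 2 * s₁ :=
    fun p h1 h2 h3 h4 => ih₁ p h1 h2 h4 h3
  rcases Nat.eq_zero_or_pos a₁ with z | pa₁
  · exact isoBound_le_of_right_eq_zero hm hmn c₀ (by omega) (by omega) ih₀ fun h _ => qa₀ h
  rcases Nat.eq_zero_or_pos b₁ with z | pb₁
  · exact isoBound_le_of_right_eq_zero hm hmn (by omega) (by omega) (by have := mb₀; omega) ih₀'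
      fun h _ => qb₀ h
  rcases Nat.eq_zero_or_pos a₀ with z | pa₀
  · rw [add_comm (s₀ : ℤ)]
    exact isoBound_le_of_right_eq_zero hm hmn c₁ (by omega) (by omega) ih₁ fun h _ => qa₁ h
  rcases Nat.eq_zero_or_pos b₀ with z | pb₀
  · rw [add_comm (s₀ : ℤ)]
    exact isoBound_le_of_right_eq_zero hm hmn (by omega) (by omega) (by omega) ih₁'
      fun h _ => qb₁ h
  rcases Nat.eq_or_lt_of_le hm with rfl | hm2
  · have i₀ := ih₀ 1 le_rfl (Or.inl rfl) pa₀ pb₀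
    have i₁ := ih₁ 1 le_rfl (Or.inl rfl) pa₁ pb₁
    have : 1 ≤ n := by
      rcases Nat.eq_zero_or_pos n with rfl | h
      · norm_num at c₀; omega
      · exact h
    unfold isoBound at *
    push_cast at *
    linarith
  · by_cases hs : m ≤ min a₀ b₀ + min a₁ b₁
    -- Both parts are at most `m - 1`, so the size restriction holds for them in dimension `n`.
    · obtain ⟨p, q, hp, hq, rfl, hp', hq'⟩ : ∃ p q : ℕ, 1 ≤ p ∧ 1 ≤ q ∧ m = p + q ∧
          p ≤ min a₀ b₀ ∧ q ≤ min a₁ b₁ := by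
        by_cases h : m ≤ min a₀ b₀
        · exact ⟨m - 1, 1, by omega, le_rfl, by omega, by omega, by omega⟩
        · refine ⟨min (min a₀ b₀) (m - 1), m - min (min a₀ b₀) (m - 1), ?_, ?_, ?_, ?_, ?_⟩ <;>
            omega
      have i₀ := ih₀ p hp (by omega) (by omega) (by omega)
      have i₁ := ih₁ q hq (by omega) (by omega) (by omega)
      have := isoBound_add (n := n) (a := p) (b := q) (by omega) (by omega)
      push_cast
      linarith
    -- The two minima belong to different sets, since either set alone has at least `m` vertices. If
    -- they are `a₀` and `b₁`, then `b₀ ≤ b₁ + s₁` gives `2 ^ n ≤ (a₀ + b₁) + s₀ + s₁`, with `a₀ +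
    -- b₁ ≤ m - 1`.
    · have := isoBound_add_le_two_pow hm hmn
      have d₀ : ((a₀ : ℤ) + b₀ + s₀) = 2 ^ n := by exact_mod_cast c₀
      have d₁ : ((a₁ : ℤ) + b₁ + s₁) = 2 ^ n := by exact_mod_cast c₁
      omega

namespace IsHLSubset

variable {V : Type u} [DecidableEq V] {G : SimpleGraph V}

/-- The partner of a vertex of `A` is not in `B`, so it lies in `A` or in the separator. -/
theorem card_inter_le_of_matching {U₀ U₁ A B : Finset V} {f : V → V}
    (hf : Set.BijOn f U₀ U₁) (hadj : ∀ x ∈ U₀, G.Adj x (f x))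
    (hAB : ∀ a ∈ A, ∀ b ∈ B, ¬ G.Adj a b) :
    (A ∩ U₀).card ≤ (A ∩ U₁).card + (U₁ \ (A ∪ B)).card := by
  refine le_trans (Finset.card_le_card_of_injOn (t := (A ∩ U₁) ∪ (U₁ \ (A ∪ B))) f ?_ ?_)
    (Finset.card_union_le _ _)
  · intro x hx
    obtain ⟨hxA, hxU⟩ := Finset.mem_inter.1 hx
    have hfx : f x ∈ U₁ := hf.mapsTo hxU
    have : f x ∉ B := fun hB => hAB x hxA _ hB (hadj x hxU)
    simp only [Finset.coe_union, Set.mem_union, Finset.mem_coe, Finset.mem_inter,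
      Finset.mem_sdiff, Finset.mem_union]
    tauto
  · exact hf.injOn.mono (by intro x hx; exact (Finset.mem_inter.1 hx).2)

theorem card_inter_le_of_matching' {U₀ U₁ A B : Finset V} {f : V → V}
    (hf : Set.BijOn f U₀ U₁) (hadj : ∀ x ∈ U₀, G.Adj x (f x))
    (hAB : ∀ a ∈ A, ∀ b ∈ B, ¬ G.Adj a b) :
    (A ∩ U₁).card ≤ (A ∩ U₀).card + (U₀ \ (A ∪ B)).card := by
  refine le_trans (Finset.card_le_card (t := ((A ∩ U₀) ∪ (U₀ \ (A ∪ B))).image f) ?_)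
    (Finset.card_image_le.trans (Finset.card_union_le _ _))
  intro y hy
  obtain ⟨hyA, hyU⟩ := Finset.mem_inter.1 hy
  obtain ⟨x, hx, rfl⟩ := hf.surjOn hyU
  have hx' : x ∈ U₀ := hx
  have : x ∉ B := fun hB => hAB _ hyA x hB (hadj x hx).symm
  refine Finset.mem_image.2 ⟨x, ?_, rfl⟩
  simp only [Finset.mem_union, Finset.mem_inter, Finset.mem_sdiff]
  tauto

theorem card_inter_add_card_inter_add {A B : Finset V} (U : Finset V) (h : Disjoint A B) :
    (A ∩ U).card + (B ∩ U).card + (U \ (A ∪ B)).card = U.card := by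
  have h1 := Finset.card_sdiff_add_card_inter U (A ∪ B)
  rw [Finset.inter_comm, Finset.union_inter_distrib_right, Finset.card_union_of_disjoint
    (h.mono Finset.inter_subset_left Finset.inter_subset_left)] at h1
  omega

theorem boundaryIn_subset_separator {A B : Finset V} (U : Finset V)
    (hAB : ∀ a ∈ A, ∀ b ∈ B, ¬ G.Adj a b) : boundaryIn G U A ⊆ U \ (A ∪ B) := by
  intro v hv
  obtain ⟨h1, h2, a, h3, h4, h5⟩ := mem_boundaryIn.1 hv
  refine Finset.mem_sdiff.2 ⟨h1, ?_⟩
  rw [Finset.mem_union]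
  rintro (h | h)
  · exact h2 h
  · exact hAB a h3 v h h5

/-- This does not follow from the boundary inequality alone: `A` and `B` may be much larger than
`m`, and `isoBound n` eventually decreases. -/
theorem isoBound_le_separator {n : ℕ} {U : Finset V} (h : IsHLSubset G n U) {A B : Finset V}
    (hd : Disjoint A B) (hAB : ∀ a ∈ A, ∀ b ∈ B, ¬ G.Adj a b) {m : ℕ} (hm : 1 ≤ m)
    (hmn : m = 1 ∨ m + 2 ≤ n) (hA : m ≤ (A ∩ U).card) (hB : m ≤ (B ∩ U).card) :
    isoBound n m ≤ 2 * (U \ (A ∪ B)).card := by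
  have hBA : ∀ b ∈ B, ∀ a ∈ A, ¬ G.Adj b a := fun b hb a ha hh => hAB a ha b hb hh.symm
  have hq : ∀ {n : ℕ} {U : Finset V}, IsHLSubset G n U → ∀ {A B : Finset V},
      (∀ a ∈ A, ∀ b ∈ B, ¬ G.Adj a b) → 1 ≤ (A ∩ U).card →
      isoBound n (A ∩ U).card ≤ 2 * (U \ (A ∪ B)).card := by
    intro n U hU A B hAB h1
    have h2 := hU.isoBound_le_boundaryIn A h1
    have h3 := Finset.card_le_card (boundaryIn_subset_separator U hAB)
    omega
  induction h generalizing m with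
  | singleton v =>
    have := card_inter_add_card_inter_add {v} hd
    rw [Finset.card_singleton] at this
    omega
  | @join n U₀ U₁ f h₀ h₁ hU hf hadj ih₀ ih₁ =>
    have hadj' : ∀ x ∈ U₀, G.Adj x (f x) := fun x hx => (hadj x hx _ (hf.mapsTo hx)).2 rfl
    rw [card_inter_union _ hU] at hA hB
    have hS : ((U₀ ∪ U₁) \ (A ∪ B)).card = (U₀ \ (A ∪ B)).card + (U₁ \ (A ∪ B)).card := by
      rw [Finset.union_sdiff_distrib, Finset.card_union_of_disjoint]
      exact hU.mono Finset.sdiff_subset Finset.sdiff_subset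
    rw [hS]
    have hc : B ∪ A = A ∪ B := Finset.union_comm _ _
    push_cast
    refine isoBound_le_of_halves hm (by omega)
      ((card_inter_add_card_inter_add U₀ hd).trans h₀.card_eq)
      ((card_inter_add_card_inter_add U₁ hd).trans h₁.card_eq) hA hB
      (card_inter_le_of_matching hf hadj' hAB) (card_inter_le_of_matching' hf hadj' hAB)
      (hc ▸ card_inter_le_of_matching hf hadj' hBA) (hc ▸ card_inter_le_of_matching' hf hadj' hBA)
      (fun p h1 h2 h3 h4 => ih₀ h1 h2 h3 h4) (fun p h1 h2 h3 h4 => ih₁ h1 h2 h3 h4)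
      (hq h₀ hAB) (hc ▸ hq h₀ hBA) (hq h₁ hAB) (hc ▸ hq h₁ hBA)

end IsHLSubset

/-! ### Binary coordinates on `D_8^k` and the HL-structure of the Cayley graph. -/

/-- The generators `a²`, `b`, `a b` of the dihedral group of order `8`. -/
def dihedralGen : Fin 3 → DihedralGroup 4 :=
  ![DihedralGroup.r 2, DihedralGroup.sr 0, DihedralGroup.sr 3]

/-- Three binary coordinates on the dihedral group of order `8`: coordinates `1` and `2` are the
homomorphisms to `ℤ/2` that are nontrivial exactly on the generator `b`, respectively `a b`;
coordinate `0` separates the two elements of each coset of the centre. -/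
def dihedralBit : DihedralGroup 4 → Fin 3 → Bool
  | DihedralGroup.r i => ![decide (2 ≤ i.val), decide (i.val % 2 = 1), decide (i.val % 2 = 1)]
  | DihedralGroup.sr i => ![decide (2 ≤ i.val), decide (i.val % 2 = 0), decide (i.val % 2 = 1)]

theorem dihedralGen_mul_self : ∀ c x, dihedralGen c * (dihedralGen c * x) = x := by decide

theorem dihedralBit_injective : ∀ x y, dihedralBit x = dihedralBit y → x = y := by decide

theorem dihedralBit_gen_mul : ∀ c x, dihedralBit (dihedralGen c * x) c = !dihedralBit x c := by
  decide

/-- Coordinate `0` is excluded because it is not a homomorphism, and `b` or `a b` may change it. -/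
theorem dihedralBit_gen_mul_of_ne : ∀ c d x, d ≠ c → d ≠ 0 →
    dihedralBit (dihedralGen c * x) d = dihedralBit x d := by decide

/-- Both equations together would give `q = a p` and `p = a q`, against `a² ≠ 1`. Here the group
differs from an elementary abelian one. -/
theorem dihedralGen_mul_swap : ∀ p q, ¬ (dihedralGen 1 * p = dihedralGen 2 * q ∧
    dihedralGen 1 * q = dihedralGen 2 * p) := by decide

namespace DihedralPower

variable {k : ℕ}

/-- The generator `a_j²`, `b_j` or `a_j b_j` of the power of the dihedral group. -/
def gen (t : Fin k × Fin 3) : Fin k → DihedralGroup 4 := Pi.mulSingle t.1 (dihedralGen t.2)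

/-- The binary coordinates on the power of the dihedral group. -/
def bit (x : Fin k → DihedralGroup 4) (t : Fin k × Fin 3) : Bool := dihedralBit (x t.1) t.2

theorem gen_mul_apply_self (t : Fin k × Fin 3) (x : Fin k → DihedralGroup 4) :
    (gen t * x) t.1 = dihedralGen t.2 * x t.1 := by
  simp [gen]

theorem gen_mul_apply_of_ne {t : Fin k × Fin 3} {j : Fin k} (h : j ≠ t.1)
    (x : Fin k → DihedralGroup 4) : (gen t * x) j = x j := by
  simp [gen, h]

theorem gen_mul_gen_mul (t : Fin k × Fin 3) (x : Fin k → DihedralGroup 4) :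
    gen t * (gen t * x) = x := by
  funext j
  by_cases h : j = t.1
  · subst h
    rw [gen_mul_apply_self, gen_mul_apply_self, dihedralGen_mul_self]
  · rw [gen_mul_apply_of_ne h, gen_mul_apply_of_ne h]

theorem eq_gen_mul_iff {t : Fin k × Fin 3} {x y : Fin k → DihedralGroup 4} :
    y = gen t * x ↔ gen t * y = x := by
  constructor
  · rintro rfl; exact gen_mul_gen_mul t x
  · rintro rfl; exact (gen_mul_gen_mul t y).symm

theorem bit_injective {x y : Fin k → DihedralGroup 4} (h : ∀ t, bit x t = bit y t) : x = y := by
  funext j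
  exact dihedralBit_injective _ _ (funext fun c => h (j, c))

theorem bit_gen_mul (t : Fin k × Fin 3) (x : Fin k → DihedralGroup 4) :
    bit (gen t * x) t = !bit x t := by
  rw [bit, gen_mul_apply_self, dihedralBit_gen_mul, bit]

theorem bit_gen_mul_of_ne {s t : Fin k × Fin 3} (h : t ≠ s) (h0 : t.2 = 0 → t.1 ≠ s.1)
    (x : Fin k → DihedralGroup 4) : bit (gen s * x) t = bit x t := by
  unfold bit
  by_cases hj : t.1 = s.1
  · rw [hj, gen_mul_apply_self, dihedralBit_gen_mul_of_ne]
    · intro hc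
      exact h (Prod.ext hj hc)
    · exact fun hc => h0 hc hj
  · rw [gen_mul_apply_of_ne hj]

theorem gen_mul_ne (t : Fin k × Fin 3) (x : Fin k → DihedralGroup 4) : gen t * x ≠ x := by
  intro h
  have := bit_gen_mul t x
  rw [h] at this
  cases hb : bit x t <;> simp [hb] at this

theorem adj_iff {x y : Fin k → DihedralGroup 4} :
    (dihedralCayleyGraph k).Adj x y ↔ ∃ t, y = gen t * x := by
  have hset : ∀ s, s ∈ dihedralConnectionSet k ↔ ∃ t, s = gen t := by
    intro s
    constructor
    · rintro ⟨i, h | h | h⟩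
      · exact ⟨(i, 0), h⟩
      · exact ⟨(i, 1), h⟩
      · exact ⟨(i, 2), h⟩
    · rintro ⟨⟨i, c⟩, h⟩
      refine ⟨i, ?_⟩
      fin_cases c
      · exact Or.inl h
      · exact Or.inr (Or.inl h)
      · exact Or.inr (Or.inr h)
  have hrel : ∀ x y, (∃ s ∈ dihedralConnectionSet k, y = s * x) ↔ ∃ t, y = gen t * x := by
    intro x y
    constructor
    · rintro ⟨s, hs, h⟩
      obtain ⟨t, rfl⟩ := (hset s).1 hs
      exact ⟨t, h⟩
    · rintro ⟨t, h⟩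
      exact ⟨gen t, (hset _).2 ⟨t, rfl⟩, h⟩
  unfold dihedralCayleyGraph cayleyGraph
  rw [SimpleGraph.fromRel_adj, hrel, hrel]
  constructor
  · rintro ⟨-, h | ⟨t, h⟩⟩
    · exact h
    · exact ⟨t, (eq_gen_mul_iff.1 h).symm⟩
  · rintro ⟨t, h⟩
    refine ⟨fun hxy => ?_, Or.inl ⟨t, h⟩⟩
    exact gen_mul_ne t x (h.symm.trans hxy.symm)

theorem adj_gen_mul (t : Fin k × Fin 3) (x : Fin k → DihedralGroup 4) :
    (dihedralCayleyGraph k).Adj x (gen t * x) := adj_iff.2 ⟨t, rfl⟩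

/-- The vertices whose binary coordinates outside `T` agree with those of `v`. -/
def subcube (T : Finset (Fin k × Fin 3)) (v : Fin k → DihedralGroup 4) :
    Finset (Fin k → DihedralGroup 4) :=
  Finset.univ.filter fun x => ∀ t, t ∉ T → bit x t = bit v t

theorem mem_subcube {T : Finset (Fin k × Fin 3)} {v x : Fin k → DihedralGroup 4} :
    x ∈ subcube T v ↔ ∀ t, t ∉ T → bit x t = bit v t := by
  simp [subcube]

theorem bit_ne_iff {x y : Fin k → DihedralGroup 4} {t : Fin k × Fin 3} :
    bit x t ≠ bit y t ↔ bit x t = !bit y t := by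
  cases bit x t <;> cases bit y t <;> simp

/-- Splitting by bit `t` gives two subcubes matched by `gen t`. The closure condition on `T` lets a
reflection change the central bit of its factor without leaving the subcube. By `htT`, central bits
are split off only when no reflection bit remains, so that no other generator inside `T` changes bit
`t`. -/
theorem isHLSubset_subcube_of_erase {T : Finset (Fin k × Fin 3)}
    (hT : ∀ j c, (j, c) ∈ T → (j, 0) ∈ T) {t : Fin k × Fin 3} (ht : t ∈ T)
    (htT : t.2 = 0 → ∀ s ∈ T, s.2 = 0)
    (ih : ∀ v, IsHLSubset (dihedralCayleyGraph k) (T.erase t).card (subcube (T.erase t) v))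
    (v : Fin k → DihedralGroup 4) :
    IsHLSubset (dihedralCayleyGraph k) T.card (subcube T v) := by
  have hgen : ∀ x s, s ∉ T → bit (gen t * x) s = bit x s := by
    intro x s hs
    refine bit_gen_mul_of_ne (fun h => hs (by rw [h]; exact ht)) (fun h0 h1 => hs ?_) x
    have : s = (t.1, 0) := Prod.ext h1 h0
    rw [this]
    exact hT t.1 t.2 ht
  have hmem : ∀ x w, x ∈ subcube (T.erase t) w ↔ bit x t = bit w t ∧ x ∈ subcube T w := by
    intro x w
    simp only [mem_subcube, Finset.mem_erase, not_and_or, not_not]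
    constructor
    · intro h
      exact ⟨h t (Or.inl rfl), fun s hs => h s (Or.inr hs)⟩
    · rintro ⟨h1, h2⟩ s (rfl | hs)
      · exact h1
      · exact h2 s hs
  have hshift : ∀ x, x ∈ subcube T (gen t * v) ↔ x ∈ subcube T v := by
    intro x
    simp only [mem_subcube]
    exact forall₂_congr fun s hs => by rw [hgen v s hs]
  have hshift' : ∀ x, gen t * x ∈ subcube T v ↔ x ∈ subcube T v := by
    intro x
    simp only [mem_subcube]
    exact forall₂_congr fun s hs => by rw [hgen x s hs]
  have hU : subcube T v = subcube (T.erase t) v ∪ subcube (T.erase t) (gen t * v) := by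
    ext x
    rw [Finset.mem_union, hmem, hmem, hshift, bit_gen_mul, ← bit_ne_iff]
    tauto
  have hcard : T.card = (T.erase t).card + 1 := (Finset.card_erase_add_one ht).symm
  rw [hU, hcard]
  refine IsHLSubset.join (fun x => gen t * x) (ih v) (ih _) ?_ ⟨?_, ?_, ?_⟩ ?_
  · rw [Finset.disjoint_left]
    intro x hx hx'
    rw [hmem] at hx hx'
    rw [bit_gen_mul, ← bit_ne_iff] at hx'
    exact hx'.1 hx.1
  · intro x hx
    have hx' := (hmem _ _).1 (Finset.mem_coe.1 hx)
    refine Finset.mem_coe.2 ((hmem _ _).2 ⟨?_, ?_⟩)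
    · rw [bit_gen_mul, bit_gen_mul, hx'.1]
    · rw [hshift, hshift']; exact hx'.2
  · intro x _ y _ h
    exact mul_left_cancel h
  · intro y hy
    have hy' := (hmem _ _).1 (Finset.mem_coe.1 hy)
    refine ⟨gen t * y, Finset.mem_coe.2 ((hmem _ _).2 ⟨?_, ?_⟩), gen_mul_gen_mul t y⟩
    · rw [bit_gen_mul, hy'.1, bit_gen_mul, Bool.not_not]
    · rw [hshift']; exact (hshift _).1 hy'.2
  · intro x hx y hy
    rw [hmem] at hx hy
    rw [hshift] at hy
    refine ⟨fun h => ?_, fun h => h ▸ adj_gen_mul t x⟩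
    obtain ⟨s, rfl⟩ := adj_iff.1 h
    by_cases hst : s = t
    · rw [hst]
    exfalso
    by_cases hs : s ∈ T
    · have h1 : bit (gen s * x) t = bit x t := by
        refine bit_gen_mul_of_ne (Ne.symm hst) (fun h0 h1 => hst ?_) x
        exact Prod.ext h1.symm ((htT h0 s hs).trans h0.symm)
      rw [h1, bit_gen_mul, ← bit_ne_iff] at hy
      exact hy.1 hx.1
    · have h1 := mem_subcube.1 hy.2 s hs
      rw [bit_gen_mul, mem_subcube.1 hx.2 s hs] at h1
      cases hb : bit v s <;> simp [hb] at h1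

theorem isHLSubset_subcube {T : Finset (Fin k × Fin 3)}
    (hT : ∀ j c, (j, c) ∈ T → (j, 0) ∈ T) (v : Fin k → DihedralGroup 4) :
    IsHLSubset (dihedralCayleyGraph k) T.card (subcube T v) := by
  induction hn : T.card generalizing T v with
  | zero =>
    rw [Finset.card_eq_zero] at hn
    subst hn
    have : subcube ∅ v = {v} := by
      ext x
      rw [mem_subcube, Finset.mem_singleton]
      exact ⟨fun h => bit_injective fun t => h t (by simp), fun h => by simp [h]⟩
    rw [this]
    exact IsHLSubset.singleton v
  | succ n ih =>
    rw [← hn]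
    by_cases h : ∃ t ∈ T, t.2 ≠ 0
    · obtain ⟨t, ht, ht0⟩ := h
      have hc : (T.erase t).card = n := by rw [Finset.card_erase_of_mem ht]; omega
      refine isHLSubset_subcube_of_erase hT ht (fun h => absurd h ht0) (fun w => ?_) v
      rw [hc]
      refine ih (fun j c hjc => ?_) w hc
      rw [Finset.mem_erase] at hjc ⊢
      exact ⟨fun h => ht0 (h ▸ rfl), hT j c hjc.2⟩
    · push Not at h
      obtain ⟨t, ht⟩ : T.Nonempty := Finset.card_pos.1 (by omega)
      have hc : (T.erase t).card = n := by rw [Finset.card_erase_of_mem ht]; omega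
      refine isHLSubset_subcube_of_erase hT ht (fun _ => h) (fun w => ?_) v
      rw [hc]
      refine ih (fun j c hjc => ?_) w hc
      have : c = 0 := h _ (Finset.mem_erase.1 hjc).2
      exact this ▸ hjc

theorem isHLSubset_univ : IsHLSubset (dihedralCayleyGraph k) (3 * k) Finset.univ := by
  have h := isHLSubset_subcube (T := (Finset.univ : Finset (Fin k × Fin 3))) (by simp) 1
  have hu : subcube (Finset.univ : Finset (Fin k × Fin 3)) 1 = Finset.univ := by
    ext x; simp [mem_subcube]
  rw [hu] at h
  simpa [mul_comm] using h

theorem isHLNetwork : IsHLNetwork (3 * k) (dihedralCayleyGraph k) := by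
  have h := (isHLSubset_univ (k := k)).isHLNetwork
  rw [Finset.coe_univ] at h
  exact h.of_iso (SimpleGraph.induceUnivIso _).symm

end DihedralPower

/-! ### Equality in the isoperimetric inequality for `Γ_{k,0}`. -/

namespace DihedralPower

variable {k : ℕ}

/-- The sets `{x | bit x s = β}` are halves of the whole graph. -/
theorem isHLSubset_filter_bit {s : Fin k × Fin 3} (hs : s.2 ≠ 0) (β : Bool) :
    ∃ n, n + 1 = 3 * k ∧
      IsHLSubset (dihedralCayleyGraph k) n (Finset.univ.filter fun x => bit x s = β) := by
  have hT : ∀ j c, (j, c) ∈ Finset.univ.erase s → (j, 0) ∈ Finset.univ.erase s := by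
    intro j c _
    simp only [Finset.mem_erase, Finset.mem_univ, and_true]
    rintro rfl
    exact hs rfl
  have hcard : (Finset.univ.erase s).card + 1 = 3 * k := by
    rw [Finset.card_erase_add_one (Finset.mem_univ s)]
    simp [mul_comm]
  obtain ⟨v, hv⟩ : ∃ v : Fin k → DihedralGroup 4, bit v s = β := by
    by_cases h : bit (1 : Fin k → DihedralGroup 4) s = β
    · exact ⟨1, h⟩
    · refine ⟨gen s * 1, ?_⟩
      rw [bit_gen_mul]
      cases β <;> cases hb : bit (1 : Fin k → DihedralGroup 4) s <;> simp_all
  refine ⟨_, hcard, ?_⟩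
  have := isHLSubset_subcube hT v
  have he : subcube (Finset.univ.erase s) v = Finset.univ.filter fun x => bit x s = β := by
    ext x
    simp [mem_subcube, hv]
  rwa [he] at this

/-- If the boundary of `A` is as small as possible, then a bit that is not constant on `A` separates
one vertex from all others, and the matching takes these to its closed neighbourhood. -/
theorem exists_minority {A : Finset (Fin k → DihedralGroup 4)}
    (hA : 2 * ((boundaryIn (dihedralCayleyGraph k) Finset.univ A).card : ℤ) ≤
      isoBound (3 * k) A.card)
    {s : Fin k × Fin 3} (hs : s.2 ≠ 0) {p q : Fin k → DihedralGroup 4} (hp : p ∈ A) (hq : q ∈ A)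
    (hpq : bit p s ≠ bit q s) :
    ∃ x ∈ A, ∀ y ∈ A, y ≠ x → bit y s ≠ bit x s ∧
      (gen s * y = x ∨ ∃ t, gen s * y = gen t * x) := by
  set G := dihedralCayleyGraph k with hG
  set H : Bool → Finset (Fin k → DihedralGroup 4) :=
    fun β => Finset.univ.filter fun x => bit x s = β with hH
  have memH : ∀ {x β}, x ∈ H β ↔ bit x s = β := by intro x β; simp [hH]
  set N := boundaryIn G Finset.univ A with hN
  have hd : Disjoint (H false) (H true) := by
    rw [Finset.disjoint_left]
    intro x h1 h2
    rw [memH] at h1 h2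
    simp [h1] at h2
  have hU : H false ∪ H true = Finset.univ := by
    ext x
    simp only [Finset.mem_union, memH, Finset.mem_univ, iff_true]
    cases bit x s <;> simp
  have hAc : (A ∩ H false).card + (A ∩ H true).card = A.card := by
    rw [← IsHLSubset.card_inter_union A hd, hU, Finset.inter_univ]
  have hNc : (N ∩ H false).card + (N ∩ H true).card = N.card := by
    rw [← IsHLSubset.card_inter_union N hd, hU, Finset.inter_univ]
  have hsub : ∀ β, boundaryIn G (H β) A ⊆ N ∩ H β := fun β =>
    Finset.subset_inter (boundaryIn_mono _ _ (Finset.subset_univ _)) (boundaryIn_subset _ _ _)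
  have hle : ∀ β, (boundaryIn G (H β) A).card ≤ (N ∩ H β).card := fun β =>
    Finset.card_le_card (hsub β)
  have hpos : ∀ β, 1 ≤ (A ∩ H β).card := by
    intro β
    refine Finset.card_pos.2 ?_
    by_cases h : bit p s = β
    · exact ⟨p, Finset.mem_inter.2 ⟨hp, memH.2 h⟩⟩
    · refine ⟨q, Finset.mem_inter.2 ⟨hq, memH.2 ?_⟩⟩
      revert hpq h
      cases bit p s <;> cases bit q s <;> cases β <;> simp
  obtain ⟨n, hn, h₀⟩ := isHLSubset_filter_bit hs false
  obtain ⟨n', hn', h₁⟩ := isHLSubset_filter_bit hs true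
  obtain rfl : n' = n := by omega
  have q₀ : isoBound n' (A ∩ H false).card ≤ 2 * (boundaryIn G (H false) A).card :=
    h₀.isoBound_le_boundaryIn A (hpos false)
  have q₁ : isoBound n' (A ∩ H true).card ≤ 2 * (boundaryIn G (H true) A).card :=
    h₁.isoBound_le_boundaryIn A (hpos true)
  have l₀ := hle false
  have l₁ := hle true
  have p₀ := hpos false
  have p₁ := hpos true
  have hn2 : (3 * k : ℤ) = n' + 1 := by exact_mod_cast hn.symm
  have hAz : (A.card : ℤ) = (A ∩ H false).card + (A ∩ H true).card := by exact_mod_cast hAc.symm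
  -- Minimality forces equality throughout the induction step: one half contains just one vertex of
  -- `A`, and every boundary vertex has a neighbour in `A` within its own half.
  have hprod : ((A ∩ H false).card - 1 : ℤ) * ((A ∩ H true).card - 1) ≤ 0 ∧
      (boundaryIn G (H false) A).card = (N ∩ H false).card ∧
      (boundaryIn G (H true) A).card = (N ∩ H true).card := by
    have key : isoBound (3 * k) A.card + 2 * (((A ∩ H false).card - 1 : ℤ) *
        ((A ∩ H true).card - 1)) = isoBound n' (A ∩ H false).card +
        isoBound n' (A ∩ H true).card := by
      rw [hAz, hn2]; unfold isoBound; ring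
    have hnn : (0 : ℤ) ≤ ((A ∩ H false).card - 1 : ℤ) * ((A ∩ H true).card - 1) :=
      mul_nonneg (by omega) (by omega)
    refine ⟨?_, ?_, ?_⟩ <;> omega
  obtain ⟨hprod, e₀, e₁⟩ := hprod
  have heq : ∀ β, boundaryIn G (H β) A = N ∩ H β := by
    intro β
    refine Finset.eq_of_subset_of_card_le (hsub β) ?_
    cases β
    · exact e₀.ge
    · exact e₁.ge
  have hone : ∃ β, (A ∩ H β).card = 1 := by
    by_contra! hcon
    have c₀ := hcon false
    have c₁ := hcon true
    have : (0 : ℤ) < ((A ∩ H false).card - 1 : ℤ) * ((A ∩ H true).card - 1) :=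
      mul_pos (by omega) (by omega)
    omega
  obtain ⟨β, hβ⟩ := hone
  obtain ⟨x, hx⟩ := Finset.card_eq_one.1 hβ
  have hxA : x ∈ A ∩ H β := by rw [hx]; exact Finset.mem_singleton_self x
  obtain ⟨hxA, hxH⟩ := Finset.mem_inter.1 hxA
  rw [memH] at hxH
  refine ⟨x, hxA, fun y hy hyx => ?_⟩
  have hyH : bit y s ≠ β := by
    intro h
    have : y ∈ A ∩ H β := Finset.mem_inter.2 ⟨hy, memH.2 h⟩
    rw [hx, Finset.mem_singleton] at this
    exact hyx this
  have hsy : bit (gen s * y) s = β := by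
    rw [bit_gen_mul]
    revert hyH
    cases bit y s <;> cases β <;> simp
  refine ⟨hxH ▸ hyH, ?_⟩
  by_cases hA' : gen s * y ∈ A
  · have : gen s * y ∈ A ∩ H β := Finset.mem_inter.2 ⟨hA', memH.2 hsy⟩
    rw [hx, Finset.mem_singleton] at this
    exact Or.inl this
  · have : gen s * y ∈ N ∩ H β := by
      refine Finset.mem_inter.2 ⟨mem_boundaryIn.2 ⟨Finset.mem_univ _, hA', y, hy,
        Finset.mem_univ _, adj_gen_mul s y⟩, memH.2 hsy⟩
    rw [← heq β] at this
    obtain ⟨-, -, a, haA, haH, hadj⟩ := mem_boundaryIn.1 this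
    have ha : a ∈ A ∩ H β := Finset.mem_inter.2 ⟨haA, haH⟩
    rw [hx, Finset.mem_singleton] at ha
    subst ha
    exact Or.inr (adj_iff.1 hadj)

/-- The indices of the generators `b_j` and `a_j b_j`. -/
def reflections (k : ℕ) : Finset (Fin k × Fin 3) := Finset.univ.filter fun t => t.2 ≠ 0

theorem mem_reflections {t : Fin k × Fin 3} : t ∈ reflections k ↔ t.2 ≠ 0 := by
  simp [reflections]

theorem card_reflections : (reflections k).card = k * 2 := by
  have : reflections k = (Finset.univ : Finset (Fin k)) ×ˢ ({1, 2} : Finset (Fin 3)) := by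
    ext ⟨j, c⟩
    simp only [mem_reflections, Finset.mem_product, Finset.mem_univ, true_and]
    revert c
    decide
  rw [this, Finset.card_product]
  simp

/-- Each reflection moves `A` off itself, and the translates are disjoint because the flipped bit
identifies the reflection. -/
theorem card_mul_le_boundaryIn {A : Finset (Fin k → DihedralGroup 4)}
    (h : ∀ s ∈ reflections k, ∀ x ∈ A, ∀ y ∈ A, bit x s = bit y s) :
    k * 2 * A.card ≤ (boundaryIn (dihedralCayleyGraph k) Finset.univ A).card := by
  rw [← card_reflections, ← Finset.card_product]
  refine Finset.card_le_card_of_injOn (fun p => gen p.1 * p.2) ?_ ?_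
  · rintro ⟨s, x⟩ hp
    obtain ⟨hs, hx⟩ := Finset.mem_product.1 (Finset.mem_coe.1 hp)
    refine Finset.mem_coe.2 (mem_boundaryIn.2 ⟨Finset.mem_univ _, fun hA => ?_, x, hx,
      Finset.mem_univ _, adj_gen_mul s x⟩)
    have := h s hs _ hA x hx
    rw [bit_gen_mul] at this
    cases hb : bit x s <;> simp [hb] at this
  · rintro ⟨s, x⟩ hp ⟨t, y⟩ hq hst
    obtain ⟨hs, hx⟩ := Finset.mem_product.1 (Finset.mem_coe.1 hp)
    obtain ⟨ht, hy⟩ := Finset.mem_product.1 (Finset.mem_coe.1 hq)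
    dsimp only at hst hs hx ht hy
    have hst' : s = t := by
      by_contra hne
      have h1 : bit (gen s * x) s = bit y s := by
        rw [hst]
        exact bit_gen_mul_of_ne hne (fun h0 => absurd h0 (mem_reflections.1 hs)) y
      rw [bit_gen_mul, h s hs x hx y hy] at h1
      cases hb : bit y s <;> simp [hb] at h1
    subst hst'
    rw [mul_left_cancel hst]

/-- `IsMinority A s x`: the bit `s` separates `x` from the other vertices of `A`, and the matching
of type `s` takes these to the closed neighbourhood of `x`. -/
def IsMinority (A : Finset (Fin k → DihedralGroup 4)) (s : Fin k × Fin 3)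
    (x : Fin k → DihedralGroup 4) : Prop :=
  x ∈ A ∧ ∀ y ∈ A, y ≠ x → bit y s ≠ bit x s ∧
    (gen s * y = x ∨ ∃ t, gen s * y = gen t * x)

namespace IsMinority

variable {A : Finset (Fin k → DihedralGroup 4)} {s t : Fin k × Fin 3}
  {x x' y : Fin k → DihedralGroup 4}

theorem bit_gen_mul_eq (h : IsMinority A s x) (hy : y ∈ A) (hyx : y ≠ x) :
    bit (gen s * y) s = bit x s := by
  have := (h.2 y hy hyx).1
  rw [bit_gen_mul]
  revert this
  cases bit y s <;> cases bit x s <;> simp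

/-- Within the closed neighbourhood of `x`, only `gen t * x` differs from `x` in the reflection bit
`t`. -/
theorem gen_mul_eq_of_bit_ne (h : IsMinority A s x) (hst : t ≠ s) (ht : t.2 ≠ 0) (hy : y ∈ A)
    (hyt : bit y t ≠ bit x t) : gen s * y = gen t * x := by
  have hyx : y ≠ x := fun h => hyt (by rw [h])
  have h1 : bit (gen s * y) t = bit y t :=
    bit_gen_mul_of_ne hst (fun h0 => absurd h0 ht) y
  rcases (h.2 y hy hyx).2 with h2 | ⟨u, h2⟩
  · rw [h2] at h1
    exact absurd h1.symm hyt
  · by_cases hu : t = u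
    · rw [hu]; exact h2
    · rw [h2, bit_gen_mul_of_ne hu (fun h0 => absurd h0 ht)] at h1
      exact absurd h1.symm hyt

theorem ne_of_ne (h : IsMinority A s x) (h' : IsMinority A t x') (hst : t ≠ s) (ht : t.2 ≠ 0)
    (hA : 3 ≤ A.card) : x ≠ x' := by
  rintro rfl
  have hsub : A ⊆ {x, gen s * (gen t * x)} := by
    intro y hy
    by_cases hyx : y = x
    · simp [hyx]
    · rw [← h.gen_mul_eq_of_bit_ne hst ht hy (h'.2 y hy hyx).1, gen_mul_gen_mul]
      simp
  have := (Finset.card_le_card hsub).trans Finset.card_le_two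
  omega

/-- Both `x` and `y` differ from `x'` in bit `t`, so they agree there. Hence the step from `x` to
`gen s * y` uses neither `s` nor `t`: it is trivial, central in the factor of `s`, or in another
factor. -/
theorem eq_or_apply_eq (h : IsMinority A s x) (h' : IsMinority A t x') (hst : t ≠ s)
    (hj : t.1 = s.1) (ht : t.2 ≠ 0) (hs : s.2 ≠ 0) (hne : x ≠ x') (hy : y ∈ A) (hyx : y ≠ x)
    (hyx' : y ≠ x') :
    y = gen s * (gen (s.1, 0) * x) ∨ dihedralGen s.2 * y s.1 = x s.1 := by
  have hb : bit y t = bit x t := by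
    have h1 := (h'.2 y hy hyx').1
    have h2 := (h'.2 x h.1 hne).1
    revert h1 h2
    cases bit y t <;> cases bit x t <;> cases bit x' t <;> simp
  rcases (h.2 y hy hyx).2 with h2 | ⟨u, h2⟩
  · right
    rw [← gen_mul_apply_self, h2]
  · by_cases hu : u.1 = s.1
    · left
      have hus : u ≠ s := by
        rintro rfl
        have := h.bit_gen_mul_eq hy hyx
        rw [h2, bit_gen_mul] at this
        cases hb : bit x u <;> simp [hb] at this
      have hut : u ≠ t := by
        rintro rfl
        have h3 : bit (gen s * y) u = bit y u :=
          bit_gen_mul_of_ne hst (fun h0 => absurd h0 ht) y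
        rw [h2, bit_gen_mul, hb] at h3
        cases hb : bit x u <;> simp [hb] at h3
      have hu0 : u = (s.1, 0) := by
        refine Prod.ext hu ?_
        have h1 : u.2 ≠ s.2 := fun h => hus (Prod.ext hu h)
        have h2 : u.2 ≠ t.2 := fun h => hut (Prod.ext (hu.trans hj.symm) h)
        have h3 : t.2 ≠ s.2 := fun h => hst (Prod.ext hj h)
        have : ∀ a b c : Fin 3, a ≠ b → a ≠ c → c ≠ b → c ≠ 0 → b ≠ 0 → a = 0 := by decide
        exact this _ _ _ h1 h2 h3 ht hs
      rw [← hu0, ← h2, gen_mul_gen_mul]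
    · right
      rw [← gen_mul_apply_self, h2, gen_mul_apply_of_ne (Ne.symm hu)]

/-- A vertex outside the four listed ones would have `j`-th entry equal to both `b x_j` and `a b
x'_j`, while `b x'_j = a b x_j`; this contradicts `dihedralGen_mul_swap`. -/
theorem false_of_same_factor {j : Fin k} (h : IsMinority A (j, 1) x)
    (h' : IsMinority A (j, 2) x') (hA : 5 ≤ A.card) : False := by
  have hne : x ≠ x' := h.ne_of_ne h' (by simp) (by simp) (by omega)
  have hsw : gen (j, 1) * x' = gen (j, 2) * x :=
    h.gen_mul_eq_of_bit_ne (by simp) (by simp) h'.1 ((h'.2 x h.1 hne).1.symm)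
  have hsw' := congrFun hsw j
  rw [gen_mul_apply_self (j, 1), gen_mul_apply_self (j, 2)] at hsw'
  dsimp only at hsw'
  have hsub : A ⊆ {x, x', gen (j, 1) * (gen (j, 0) * x), gen (j, 2) * (gen (j, 0) * x')} := by
    intro y hy
    simp only [Finset.mem_insert, Finset.mem_singleton]
    by_contra! hcon
    obtain ⟨n1, n2, n3, n4⟩ := hcon
    have e1 := (h.eq_or_apply_eq h' (by simp) rfl (by simp) (by simp) hne hy n1 n2).resolve_left n3
    have e2 := (h'.eq_or_apply_eq h (by simp) rfl (by simp) (by simp) hne.symm hy n2 n1).resolve_left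
      n4
    dsimp only at e1 e2
    have e1' : y j = dihedralGen 1 * x j := by rw [← e1, dihedralGen_mul_self]
    have e2' : y j = dihedralGen 2 * x' j := by rw [← e2, dihedralGen_mul_self]
    exact dihedralGen_mul_swap _ _ ⟨e1'.symm.trans e2', hsw'⟩
  have := (Finset.card_le_card hsub).trans Finset.card_le_four
  omega

end IsMinority

theorem isoBound_lt_boundaryIn {A : Finset (Fin k → DihedralGroup 4)} (hk : 2 ≤ k)
    (hA : 2 * k + 2 ≤ A.card) :
    isoBound (3 * k) A.card <
      2 * (boundaryIn (dihedralCayleyGraph k) Finset.univ A).card := by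
  classical
  by_contra! hcon
  let D := (reflections k).filter fun s => ∃ p ∈ A, ∃ q ∈ A, bit p s ≠ bit q s
  have memD : ∀ {s}, s ∈ D ↔ s.2 ≠ 0 ∧ ∃ p ∈ A, ∃ q ∈ A, bit p s ≠ bit q s := by
    intro s; simp [D, mem_reflections]
  have hmin : ∀ s, ∃ x, s ∈ D → IsMinority A s x := by
    intro s
    by_cases hs : s ∈ D
    · obtain ⟨h0, p, hp, q, hq, hpq⟩ := memD.1 hs
      obtain ⟨x, hx, h⟩ := exists_minority hcon h0 hp hq hpq
      exact ⟨x, fun _ => ⟨hx, h⟩⟩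
    · exact ⟨1, fun h => absurd h hs⟩
  choose x hx using hmin
  have hDcard : D.card ≤ k := by
    have : D.card ≤ (Finset.univ : Finset (Fin k)).card := by
      refine Finset.card_le_card_of_injOn Prod.fst (fun _ _ => Finset.mem_coe.2 (Finset.mem_univ _))
        ?_
      rintro ⟨j, c⟩ hc ⟨j', d⟩ hd hj
      obtain rfl : j = j' := hj
      have hc := Finset.mem_coe.1 hc
      have hd := Finset.mem_coe.1 hd
      have hcd : ∀ c d : Fin 3, c ≠ 0 → d ≠ 0 → c = d ∨ c = 1 ∧ d = 2 ∨ c = 2 ∧ d = 1 := by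
        decide
      rcases hcd c d (memD.1 hc).1 (memD.1 hd).1 with rfl | ⟨rfl, rfl⟩ | ⟨rfl, rfl⟩
      · rfl
      · exact ((hx _ hc).false_of_same_factor (hx _ hd) (by omega)).elim
      · exact ((hx _ hd).false_of_same_factor (hx _ hc) (by omega)).elim
    simpa using this
  -- With `m = |A|` and no splitting reflection, `4 k m ≤ 6 k m - (m - 1) (m + 2)`, which fails for
  -- `m ≥ 2 k + 2`.
  rcases D.eq_empty_or_nonempty with hD | ⟨s, hs⟩
  · have hconst : ∀ s ∈ reflections k, ∀ p ∈ A, ∀ q ∈ A, bit p s = bit q s := by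
      intro s hs p hp q hq
      by_contra hpq
      have : s ∈ D := memD.2 ⟨mem_reflections.1 hs, p, hp, q, hq, hpq⟩
      simp [hD] at this
    have h1 := card_mul_le_boundaryIn hconst
    have h2 : ((k : ℤ) * 2 * A.card) ≤
        (boundaryIn (dihedralCayleyGraph k) Finset.univ A).card := by exact_mod_cast h1
    have h3 : (2 * k + 2 : ℤ) ≤ A.card := by exact_mod_cast hA
    unfold isoBound at hcon
    nlinarith
  -- Every vertex of `A` is a minority vertex of some reflection in `D`, or its `s`-partner is `x s`
  -- or a central neighbour of `x s`. This allows at most `k + 1 + k` vertices.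
  · have hsub : A ⊆ D.image x ∪ insert (gen s * x s)
        (Finset.univ.image fun j : Fin k => gen s * (gen (j, 0) * x s)) := by
      intro y hy
      simp only [Finset.mem_union, Finset.mem_image, Finset.mem_insert, Finset.mem_univ, true_and]
      by_cases hys : y = x s
      · exact Or.inl ⟨s, hs, hys.symm⟩
      rcases ((hx s hs).2 y hy hys).2 with h | ⟨t, h⟩
      · right; left
        rw [← h, gen_mul_gen_mul]
      · by_cases ht : t.2 = 0
        · right; right
          refine ⟨t.1, ?_⟩
          rw [show ((t.1, 0) : Fin k × Fin 3) = t from Prod.ext rfl ht.symm, ← h, gen_mul_gen_mul]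
        · left
          have hts : t ≠ s := by
            rintro rfl
            exact hys (mul_left_cancel h)
          have hyt : bit y t ≠ bit (x s) t := by
            have h1 : bit (gen s * y) t = bit y t :=
              bit_gen_mul_of_ne hts (fun h0 => absurd h0 ht) y
            rw [h, bit_gen_mul] at h1
            rw [← h1]
            cases bit (x s) t <;> simp
          have htD : t ∈ D := memD.2 ⟨ht, y, hy, x s, (hx s hs).1, hyt⟩
          refine ⟨t, htD, ?_⟩
          -- Otherwise `y` and `x s` both differ from `x t` in bit `t`, hence agree there, against
          -- `hyt`.
          by_contra hyxt
          have h1 := ((hx t htD).2 y hy (Ne.symm hyxt)).1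
          have hne : x s ≠ x t := (hx s hs).ne_of_ne (hx t htD) hts ht (by omega)
          have h2 := ((hx t htD).2 _ (hx s hs).1 hne).1
          revert h1 h2 hyt
          cases bit y t <;> cases bit (x s) t <;> cases bit (x t) t <;> simp
    have h1 := Finset.card_le_card hsub
    have h2 := Finset.card_union_le (D.image x) (insert (gen s * x s)
        (Finset.univ.image fun j : Fin k => gen s * (gen (j, 0) * x s)))
    have h3 := Finset.card_insert_le (gen s * x s)
        (Finset.univ.image fun j : Fin k => gen s * (gen (j, 0) * x s))
    have h4 : (D.image x).card ≤ D.card := Finset.card_image_le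
    have h5 : (Finset.univ.image fun j : Fin k => gen s * (gen (j, 0) * x s)).card ≤ k :=
      Finset.card_image_le.trans (by simp)
    omega

end DihedralPower

/-! ### Extra cutsets and the lower bound for the connectivity. -/

/-- If `S` is an `R_g`-cutset, then the vertices outside `S` fall into two nonadjacent parts with at
least `g + 1` vertices each. -/
theorem IsExtraCutset.exists_separation {V : Type u} [Fintype V] [DecidableEq V]
    {G : SimpleGraph V} {g : ℕ} {S : Finset V} (h : IsExtraCutset G g S) :
    ∃ A B : Finset V, Disjoint A B ∧ (∀ a ∈ A, ∀ b ∈ B, ¬ G.Adj a b) ∧ Finset.univ \ (A ∪ B) = S ∧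
      g + 1 ≤ A.card ∧ g + 1 ≤ B.card := by
  classical
  obtain ⟨hc, hg⟩ := h
  unfold SimpleGraph.Preconnected at hc
  push Not at hc
  obtain ⟨u, v, huv⟩ := hc
  set H := G.induce ((S : Set V)ᶜ) with hH
  have himg : ∀ C : H.ConnectedComponent,
      g + 1 ≤ (Finset.univ.filter fun x => ∃ hx : x ∈ ((S : Set V)ᶜ),
        H.connectedComponentMk ⟨x, hx⟩ = C).card := by
    intro C
    refine (hg C).trans (le_of_eq ?_)
    rw [← Set.ncard_image_of_injective _ Subtype.val_injective, ← Set.ncard_coe_finset]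
    congr 1
    ext x
    simp only [Set.mem_image, SimpleGraph.ConnectedComponent.mem_supp_iff, Subtype.exists,
      exists_and_right, exists_eq_right, Finset.coe_filter, Finset.mem_univ, true_and,
      Set.mem_ofPred_eq]
  refine ⟨Finset.univ.filter fun x => ∃ hx : x ∈ ((S : Set V)ᶜ),
      H.connectedComponentMk ⟨x, hx⟩ = H.connectedComponentMk u,
    Finset.univ.filter fun x => ∃ hx : x ∈ ((S : Set V)ᶜ),
      H.connectedComponentMk ⟨x, hx⟩ ≠ H.connectedComponentMk u, ?_, ?_, ?_, himg _, ?_⟩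
  · rw [Finset.disjoint_left]
    intro x hx hx'
    obtain ⟨-, h1, h2⟩ := Finset.mem_filter.1 hx
    obtain ⟨-, h3, h4⟩ := Finset.mem_filter.1 hx'
    exact h4 h2
  · intro a ha b hb hab
    obtain ⟨-, h1, h2⟩ := Finset.mem_filter.1 ha
    obtain ⟨-, h3, h4⟩ := Finset.mem_filter.1 hb
    refine h4 (Eq.trans ?_ h2)
    have : H.Adj ⟨b, h3⟩ ⟨a, h1⟩ := hab.symm
    exact SimpleGraph.ConnectedComponent.eq.2 this.reachable
  · ext x
    simp only [Finset.mem_sdiff, Finset.mem_univ, true_and, Finset.mem_union, Finset.mem_filter,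
      ← exists_or]
    constructor
    · intro h
      by_contra hx
      exact h ⟨hx, em _⟩
    · rintro hx ⟨hx', -⟩
      exact hx' hx
  · refine (himg (H.connectedComponentMk v)).trans (Finset.card_le_card ?_)
    intro x hx
    obtain ⟨-, h1, h2⟩ := Finset.mem_filter.1 hx
    refine Finset.mem_filter.2 ⟨Finset.mem_univ _, h1, ?_⟩
    rw [h2]
    exact fun h => huv (SimpleGraph.ConnectedComponent.eq.1 h.symm)

theorem extraBound_eq (n g : ℕ) : extraBound n g = (isoBound n (g + 1 : ℕ) : ℤ) / 2 := by
  unfold extraBound isoBound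
  push_cast
  ring

namespace DihedralPower

variable {k : ℕ}

theorem isoBound_lt_card_of_isExtraCutset {g : ℕ} (hg : 2 * k + 1 ≤ g) (hgk : g + 4 ≤ 3 * k)
    {S : Finset (Fin k → DihedralGroup 4)} (hS : IsExtraCutset (dihedralCayleyGraph k) g S) :
    isoBound (3 * k) (g + 1 : ℕ) < 2 * S.card := by
  obtain ⟨A, B, hd, hAB, rfl, hA, hB⟩ := hS.exists_separation
  have hBA : ∀ b ∈ B, ∀ a ∈ A, ¬ (dihedralCayleyGraph k).Adj b a :=
    fun b hb a ha hh => hAB a ha b hb hh.symm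
  have small : ∀ {A B : Finset (Fin k → DihedralGroup 4)},
      (∀ a ∈ A, ∀ b ∈ B, ¬ (dihedralCayleyGraph k).Adj a b) → A.card = g + 1 →
      isoBound (3 * k) (g + 1 : ℕ) < 2 * (Finset.univ \ (A ∪ B)).card := by
    intro A B hAB hA
    have h1 := isoBound_lt_boundaryIn (A := A) (by omega) (by omega)
    have h2 := Finset.card_le_card (IsHLSubset.boundaryIn_subset_separator Finset.univ hAB)
    rw [hA] at h1
    omega
  rcases Nat.eq_or_lt_of_le hA with hA' | hA'
  · exact small hAB hA'.symm
  rcases Nat.eq_or_lt_of_le hB with hB' | hB'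
  · rw [Finset.union_comm]
    exact small hBA hB'.symm
  -- The restriction `m + 2 ≤ 3 k` is exactly `g ≤ 3 k - 4`. Passing from `g + 1` to `g + 2` raises
  -- `isoBound` by `2 (3 k - g - 2) > 0`.
  have h1 := isHLSubset_univ.isoBound_le_separator hd hAB (m := g + 2) (by omega) (by omega)
    (by rw [Finset.inter_univ]; omega) (by rw [Finset.inter_univ]; omega)
  refine lt_of_lt_of_le ?_ h1
  have h2 : (g : ℤ) + 4 ≤ 3 * k := by exact_mod_cast hgk
  unfold isoBound
  push_cast
  nlinarith

theorem gen_injective : Function.Injective (gen : Fin k × Fin 3 → Fin k → DihedralGroup 4) := by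
  intro s t h
  have h1 : s.1 = t.1 := by
    by_contra hne
    have h2 := congrFun h s.1
    have h3 : ∀ c, dihedralGen c ≠ 1 := by decide
    simp only [gen, Pi.mulSingle_eq_same] at h2
    rw [Pi.mulSingle_eq_of_ne hne] at h2
    exact h3 _ h2
  refine Prod.ext h1 ?_
  have h2 := congrFun h s.1
  have h3 : ∀ c d, dihedralGen c = dihedralGen d → c = d := by decide
  simp only [gen, ← h1, Pi.mulSingle_eq_same] at h2
  exact h3 _ _ h2

/-- Keeping only the vertices whose entry in one factor is one of two nonadjacent vertices of that
factor leaves a disconnected graph with large components. -/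
theorem exists_isExtraCutset {g : ℕ} (hk : 0 < k) (hg : g + 4 ≤ 3 * k) :
    ∃ S, IsExtraCutset (dihedralCayleyGraph k) g S := by
  classical
  let j : Fin k := ⟨0, hk⟩
  let P : DihedralGroup 4 → Prop := fun a => a = 1 ∨ a = DihedralGroup.r 1
  have hP : ∀ c a, P a → ¬ P (dihedralGen c * a) := by
    have : ∀ (c : Fin 3) (a : DihedralGroup 4), (a = 1 ∨ a = DihedralGroup.r 1) →
        ¬ (dihedralGen c * a = 1 ∨ dihedralGen c * a = DihedralGroup.r 1) := by decide
    exact this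
  let S : Finset (Fin k → DihedralGroup 4) := Finset.univ.filter fun x => ¬ P (x j)
  have memS : ∀ x, x ∈ ((S : Set (Fin k → DihedralGroup 4))ᶜ) ↔ P (x j) := by
    intro x; simp [S]
  refine ⟨S, ?_, ?_⟩
  · intro hcon
    have hinv : ∀ x y, ((dihedralCayleyGraph k).induce
        ((S : Set (Fin k → DihedralGroup 4))ᶜ)).Reachable x y → x.1 j = y.1 j := by
      rintro x y ⟨w⟩
      induction w with
      | nil => rfl
      | @cons x y z hxy w ih =>
        refine Eq.trans ?_ ih
        obtain ⟨t, ht⟩ := adj_iff.1 (show (dihedralCayleyGraph k).Adj x.1 y.1 from hxy)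
        by_cases htj : j = t.1
        · have h1 := (memS _).1 y.2
          rw [ht, htj, gen_mul_apply_self, ← htj] at h1
          exact absurd h1 (hP _ _ ((memS _).1 x.2))
        · rw [ht, gen_mul_apply_of_ne htj]
    have h1 : (1 : Fin k → DihedralGroup 4) ∈ ((S : Set (Fin k → DihedralGroup 4))ᶜ) :=
      (memS _).2 (Or.inl rfl)
    have h2 : (fun _ => DihedralGroup.r 1 : Fin k → DihedralGroup 4) ∈
        ((S : Set (Fin k → DihedralGroup 4))ᶜ) := (memS _).2 (Or.inr rfl)
    have h3 := hinv _ _ (hcon ⟨_, h1⟩ ⟨_, h2⟩)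
    have h4 : (1 : DihedralGroup 4) ≠ DihedralGroup.r 1 := by decide
    exact h4 h3
  · intro C
    obtain ⟨⟨v, hv⟩, rfl⟩ := C.exists_rep
    -- The `3 (k - 1)` neighbours of `v` through the other factors survive, and `3 k - 3 ≥ g + 1`.
    let T : Finset (Fin k × Fin 3) := (Finset.univ.erase j) ×ˢ Finset.univ
    have hT : T.card = (k - 1) * 3 := by simp [T]
    have hmem : ∀ t ∈ T, gen t * v ∈ ((S : Set (Fin k → DihedralGroup 4))ᶜ) := by
      intro t ht
      have : t.1 ≠ j := by
        have := (Finset.mem_product.1 ht).1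
        exact Finset.ne_of_mem_erase this
      rw [memS, gen_mul_apply_of_ne this.symm]
      exact (memS _).1 hv
    have hsub : ((T.image fun t => gen t * v : Finset _) : Set (Fin k → DihedralGroup 4)) ⊆
        Subtype.val '' (((dihedralCayleyGraph k).induce
        ((S : Set (Fin k → DihedralGroup 4))ᶜ)).connectedComponentMk ⟨v, hv⟩).supp := by
      intro y hy
      obtain ⟨t, ht, rfl⟩ := Finset.mem_image.1 (Finset.mem_coe.1 hy)
      refine ⟨⟨_, hmem t ht⟩, ?_, rfl⟩
      rw [SimpleGraph.ConnectedComponent.mem_supp_iff, SimpleGraph.ConnectedComponent.eq]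
      have : ((dihedralCayleyGraph k).induce
        ((S : Set (Fin k → DihedralGroup 4))ᶜ)).Adj ⟨v, hv⟩ ⟨_, hmem t ht⟩ := adj_gen_mul t v
      exact this.symm.reachable
    have hle := Set.ncard_le_ncard hsub
    rw [Set.ncard_coe_finset, Set.ncard_image_of_injective _ Subtype.val_injective,
      Finset.card_image_of_injective, hT] at hle
    · refine le_trans ?_ hle
      omega
    · intro s t h
      exact gen_injective (mul_right_cancel h)

theorem extraBound_lt_extraConnectivity {g : ℕ} (hg : 2 * k + 1 ≤ g) (hgk : g + 4 ≤ 3 * k) :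
    extraBound (3 * k) g < (extraConnectivity (dihedralCayleyGraph k) g : ℚ) := by
  obtain ⟨S₀, hS₀⟩ := exists_isExtraCutset (k := k) (g := g) (by omega) (by omega)
  obtain ⟨S, hS, hcard⟩ := Nat.sInf_mem
    (s := {m : ℕ | ∃ S : Finset _, IsExtraCutset (dihedralCayleyGraph k) g S ∧ S.card = m})
    ⟨_, S₀, hS₀, rfl⟩
  have h := isoBound_lt_card_of_isExtraCutset hg hgk hS
  rw [hcard] at h
  rw [extraBound_eq, div_lt_iff₀ two_pos, mul_comm _ (2 : ℚ), extraConnectivity]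
  exact_mod_cast h

end DihedralPower

theorem mainTheorem2 :
    (∀ k : ℕ, IsHLNetwork (3 * k) (dihedralCayleyGraph k)) ∧
    (∀ k g : ℕ, 2 * k + 1 ≤ g → g + 4 ≤ 3 * k →
      (∃ S, IsExtraCutset (dihedralCayleyGraph k) g S) ∧
      extraBound (3 * k) g < (extraConnectivity (dihedralCayleyGraph k) g : ℚ)) ∧
    ¬ (∀ (n : ℕ) (V : Type) (G : SimpleGraph V) (g : ℕ), 5 ≤ n → g + 3 ≤ n → IsHLNetwork n G →
      (∃ S, IsExtraCutset G g S) → (extraConnectivity G g : ℚ) = extraBound n g) := by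
  refine ⟨fun k => DihedralPower.isHLNetwork, fun k g hg hgk =>
    ⟨DihedralPower.exists_isExtraCutset (by omega) (by omega),
      DihedralPower.extraBound_lt_extraConnectivity hg hgk⟩, fun h => ?_⟩
  -- The range `2 k + 1 ≤ g ≤ 3 k - 4` is first nonempty at `k = 5`, where it contains only `g =
  -- 11`.
  have h1 := h (3 * 5) _ (dihedralCayleyGraph 5) 11 (by norm_num) (by norm_num)
    DihedralPower.isHLNetwork (DihedralPower.exists_isExtraCutset (by norm_num) (by norm_num))
  have h2 := DihedralPower.extraBound_lt_extraConnectivity (k := 5) (g := 11) (by norm_num)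
    (by norm_num)
  exact h2.ne' h1
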